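/- Let $X=(X_t)_{t\in\mathbb{R}}$ be a two-sided real-valued Lévy process on a probability space, that is, a process with càdlàg paths and stationary independent increments indexed by $\mathbb{R}$, with $X_0=0$. Suppose that $\mathbb{E}[X_1^+]<\infty$, so that $\mathbb{E}[X_1]\in[-\infty,\infty)$ is well defined, and let $\alpha\in\mathbb{R}$ satisfy $\alpha>\mathbb{E}[X_1]$. Put \[ L_t:=\inf\{X_s+\alpha(t-s): s\le t\},\qquad \mathcal{H}_\alpha:=\{t\in\mathbb{R}: X_t\wedge X_{t-}=L_t\}, \] \[ \mathcal{R}_\alpha:=\Bigl\{t\in\mathbb{R}: X_t-\alpha t=\inf_{u\le t}(X_u-\alpha u)\Bigr\}. \] Then the following hold almost surely. (i) $\mathcal{R}_\alpha\subseteq\mathcal{H}_\alpha$. (ii) $\mathcal{R}_\alpha$ is closed from the right: if $t_n\in\mathcal{R}_\alpha$ for all $n$ and $t_n\downarrow t\in\mathbb{R}$, then $t\in\mathcal{R}_\alpha$. (iii) The closure of $\mathcal{R}_\alpha$ is $\mathcal{H}_\alpha$. (iv) Every $t\in\mathcal{H}_\alpha\setminus\mathcal{R}_\alpha$ is a point of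 $\mathcal{H}_\alpha$ that is isolated on the right, i.e. $(t,t+\varepsilon)\cap\mathcal{H}_\alpha=\emptyset$ for some $\varepsilon>0$; in particular $\mathcal{H}_\alpha\setminus\mathcal{R}_\alpha$ is countable. -/

import Mathlib

open MeasureTheory ProbabilityTheory Filter Topology

noncomputable section

/-- A function `ℝ → ℝ` is càdlàg: right-continuous, with (finite) left limits, at every point. -/
def IsCadlagPath (f : ℝ → ℝ) : Prop :=
  ∀ t : ℝ, ContinuousWithinAt f (Set.Ici t) t ∧ ∃ l : ℝ, Tendsto f (𝓝[<] t) (𝓝 l)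

/-- A two-sided real-valued Lévy process started from `0`: càdlàg paths, stationary and
independent increments (over the whole time set `ℝ`), and `X 0 = 0`. -/
structure IsTwoSidedLevyProcess {Ω : Type*} [MeasurableSpace Ω] (X : ℝ → Ω → ℝ)
    (P : Measure Ω) : Prop where
  measurable : ∀ t : ℝ, Measurable (X t)
  cadlag : ∀ ω : Ω, IsCadlagPath (fun t => X t ω)
  zero : ∀ ω : Ω, X 0 ω = 0
  indepIncrements : HasIndepIncrements X P
  stationaryIncrements : ∀ s t h : ℝ, 0 ≤ h →
    IdentDistrib (fun ω => X (s + h) ω - X s ω) (fun ω => X (t + h) ω - X t ω) P P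

/-- The extended expectation `𝔼[Y⁺] - 𝔼[Y⁻] ∈ [-∞, ∞]`; it is only used when `𝔼[Y⁺] < ∞`, so that
it is well defined, possibly `-∞`. -/
def extExpectation {Ω : Type*} [MeasurableSpace Ω] (Y : Ω → ℝ) (P : Measure Ω) : EReal :=
  ((∫⁻ ω, ENNReal.ofReal (Y ω) ∂P : ENNReal) : EReal) -
    ((∫⁻ ω, ENNReal.ofReal (-Y ω) ∂P : ENNReal) : EReal)

/-- `L_t = inf {f s + α (t - s) : s ≤ t}`, as an extended real (no junk value when the infimum
is `-∞`). -/
def lowerEnvelope (α : ℝ) (f : ℝ → ℝ) (t : ℝ) : EReal :=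
  ⨅ (s : ℝ) (_ : s ≤ t), ((f s + α * (t - s) : ℝ) : EReal)

/-- The contact set `H_α = {t : f t ∧ f (t-) = L_t}` of a path `f`. -/
def contactSet (α : ℝ) (f : ℝ → ℝ) : Set ℝ :=
  {t : ℝ | ((min (f t) (Function.leftLim f t) : ℝ) : EReal) = lowerEnvelope α f t}

/-- The ladder time set `R_α = {t : f t - α t = inf_{u ≤ t} (f u - α u)}` of a path `f`. -/
def ladderTimeSet (α : ℝ) (f : ℝ → ℝ) : Set ℝ :=
  {t : ℝ | ((f t - α * t : ℝ) : EReal) = ⨅ (u : ℝ) (_ : u ≤ t), ((f u - α * u : ℝ) : EReal)}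

/-- `S` is closed from the right: the limit of every decreasing convergent sequence of points
of `S` belongs to `S`. -/
def IsClosedFromRight (S : Set ℝ) : Prop :=
  ∀ (u : ℕ → ℝ) (t : ℝ), Antitone u → Tendsto u atTop (𝓝 t) → (∀ n, u n ∈ S) → t ∈ S

/-- `t` is a point of `S` that is isolated on the right. -/
def IsIsolatedOnRight (S : Set ℝ) (t : ℝ) : Prop :=
  t ∈ S ∧ ∃ ε : ℝ, 0 < ε ∧ Set.Ioo t (t + ε) ∩ S = ∅

end

/-! ### First passage and later increments of a random walk. -/

section DiscreteTime

/-! Put `y s = X s - α s`, again a Lévy process. All but `contactSet ⊆ closure ladderTimeSet` holds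
path by path for càdlàg functions: a contact time `t` outside the ladder set has left limit `c` of
`y` equal to the infimum over `(-∞, t]` and an upward jump, and right-continuity keeps `y` away from
`c` just after `t`.

If such a `t` lies outside the closure as well, choose a rational `u < t` with no ladder time in
`[u, t)`. The infimum over `(-∞, u]` is then already `c`, and the first time `T > u` at which `y`
comes arbitrarily close to `c` is reached by a left limit, followed by a jump up. But `T` is
announced by the first passages below `c + ε`, and a Lévy process does not jump at a predictable
time. On dyadic grids this is `measure_risesAfterFirstPassage_le`: a rise by `x` within time `η`
after the passage is no likelier than one from time `0`, which has probability tending to `0` with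
`η`. By `LeavesMinimumByJump.exists_risesAfterFirstPassage` the jump at `T` forces such rises for
every `η`; there are countably many `u`. -/

theorem measurable_sub_iSup_comap_increments {Ω : Type*} (S : ℕ → Ω → ℝ) {m n : ℕ} (hmn : m ≤ n)
    {T : Set ℕ}
    (hT : ∀ i, m ≤ i → i < n → i ∈ T) :
    Measurable[⨆ i ∈ T, MeasurableSpace.comap (fun ω => S (i + 1) ω - S i ω) inferInstance]
      (fun ω => S n ω - S m ω) := by
  have h : (fun ω => S n ω - S m ω) =
      fun ω => ∑ i ∈ Finset.Ico m n, (S (i + 1) ω - S i ω) := by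
    funext ω
    exact (Finset.sum_Ico_sub (fun i => S i ω) hmn).symm
  rw [h]
  refine Finset.measurable_fun_sum _ fun i hi => ?_
  rw [Finset.mem_Ico] at hi
  refine Measurable.mono (comap_measurable _) ?_ le_rfl
  exact le_iSup₂_of_le (f := fun i (_ : i ∈ T) =>
    MeasurableSpace.comap (fun ω => S (i + 1) ω - S i ω) inferInstance) i (hT i hi.1 hi.2) le_rfl

variable {Ω : Type*} [mΩ : MeasurableSpace Ω] {P : Measure Ω}

/-- The paths `z` that, at the first time `M + k` at which they lie less than `ε` above all their
values up to time `M`, start to rise by more than `x` within `W` steps. -/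
def RisesAfterFirstPassage (z : ℕ → ℝ) (M W : ℕ) (ε x : ℝ) : Prop :=
  ∃ k : ℕ, ((∀ i ≤ M, z (M + k) - z i < ε) ∧ ∀ k' < k, ∃ i ≤ M, ε ≤ z (M + k') - z i) ∧
    ∃ w ≤ W, x < z (M + k + w) - z (M + k)

/-- A strong Markov property: the events `A k` that the passage occurs at step `k` are disjoint and
depend on increments before `M + k`, hence are independent of the later rise `J (M + k)`. Comparing
with values up to `M`, rather than with a fixed level, leaves only increments involved. -/
theorem measure_risesAfterFirstPassage_le [IsProbabilityMeasure P] (S : ℕ → Ω → ℝ)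
    (hS : ∀ i, Measurable (S i))
    (hind : iIndepFun (fun i ω => S (i + 1) ω - S i ω) P) (M W : ℕ) (ε x : ℝ) (q : ENNReal)
    (hq : ∀ m, P {ω | ∃ w ≤ W, x < S (m + w) ω - S m ω} ≤ q) :
    P {ω | RisesAfterFirstPassage (fun i => S i ω) M W ε x} ≤ q := by
  set F : ℕ → MeasurableSpace Ω :=
    fun i => MeasurableSpace.comap (fun ω => S (i + 1) ω - S i ω) inferInstance with hF
  have hFle : ∀ i, F i ≤ mΩ := fun i => ((hS (i + 1)).sub (hS i)).comap_le
  set G : ℕ → Set Ω := fun k => {ω | ∀ i ≤ M, S (M + k) ω - S i ω < ε} with hG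
  set A : ℕ → Set Ω := fun k =>
    {ω | (∀ i ≤ M, S (M + k) ω - S i ω < ε) ∧ ∀ k' < k, ∃ i ≤ M, ε ≤ S (M + k') ω - S i ω} with hA
  set J : ℕ → Set Ω := fun m => {ω | ∃ w ≤ W, x < S (m + w) ω - S m ω} with hJ
  have hGm : ∀ k K, k ≤ K → MeasurableSet[⨆ i ∈ Set.Iio (M + K), F i] (G k) := by
    intro k K hkK
    have : G k = ⋂ i ∈ Set.Iic M, {ω | S (M + k) ω - S i ω < ε} := by
      ext ω; simp [hG]
    rw [this]
    refine MeasurableSet.biInter (Set.to_countable _) fun i hi => ?_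
    have hi' : i ≤ M := hi
    exact measurable_sub_iSup_comap_increments S (show i ≤ M + k by omega)
      (T := Set.Iio (M + K)) (fun j _ hj => show j < M + K by omega) measurableSet_Iio
  have hAG : ∀ k, A k = G k \ ⋃ k' ∈ Set.Iio k, G k' := by
    intro k
    ext ω
    simp [hA, hG]
  have hAm : ∀ k, MeasurableSet[⨆ i ∈ Set.Iio (M + k), F i] (A k) := by
    intro k
    rw [hAG]
    exact (hGm k k le_rfl).diff (MeasurableSet.biUnion (Set.to_countable _)
      fun k' hk' => hGm k' k (le_of_lt hk'))
  have hJm : ∀ m, MeasurableSet[⨆ i ∈ Set.Ici m, F i] (J m) := by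
    intro m
    have : J m = ⋃ w ∈ Set.Iic W, {ω | x < S (m + w) ω - S m ω} := by
      ext ω; simp [hJ]
    rw [this]
    refine MeasurableSet.biUnion (Set.to_countable _) fun w _ => ?_
    exact measurable_sub_iSup_comap_increments S (Nat.le_add_right m w)
      (T := Set.Ici m) (fun j hj _ => hj) measurableSet_Ioi
  have hAJ : ∀ k, P (A k ∩ J (M + k)) = P (A k) * P (J (M + k)) := by
    intro k
    have hI := indep_iSup_of_disjoint hFle hind.iIndep
      (S := Set.Iio (M + k)) (T := Set.Ici (M + k))
      (Set.disjoint_left.2 fun i (hi : i < M + k) (hi' : M + k ≤ i) => absurd hi (not_lt.2 hi'))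
    exact (Indep_iff _ _ _).1 hI _ _ (hAm k) (hJm _)
  have hAmeas : ∀ k, MeasurableSet (A k) := fun k =>
    (iSup₂_le fun i _ => hFle i : (⨆ i ∈ Set.Iio (M + k), F i) ≤ mΩ) _ (hAm k)
  have hdisj : Pairwise (Function.onFun Disjoint A) := by
    have key : ∀ a b, a < b → Disjoint (A a) (A b) := by
      intro a b hab
      rw [Set.disjoint_left]
      rintro ω ⟨h1, -⟩ ⟨-, h2⟩
      obtain ⟨i, hi, h⟩ := h2 a hab
      exact absurd (h1 i hi) (not_lt.2 h)
    intro a b hab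
    rcases lt_or_gt_of_ne hab with h | h
    · exact key a b h
    · exact (key b a h).symm
  calc P {ω | RisesAfterFirstPassage (fun i => S i ω) M W ε x}
      ≤ P (⋃ k, A k ∩ J (M + k)) := by
        refine measure_mono ?_
        rintro ω ⟨k, h1, h2⟩
        exact Set.mem_iUnion.2 ⟨k, h1, h2⟩
    _ ≤ ∑' k, P (A k ∩ J (M + k)) := measure_iUnion_le _
    _ ≤ ∑' k, P (A k) * q := by
        refine ENNReal.tsum_le_tsum fun k => ?_
        rw [hAJ]
        gcongr
        exact hq _
    _ = P (⋃ k, A k) * q := by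
        rw [ENNReal.tsum_mul_right, measure_iUnion hdisj hAmeas]
    _ ≤ 1 * q := by gcongr; exact prob_le_one
    _ = q := one_mul q

/-- Continuity from below along the tail intersections, which increase; no measurability is
required. -/
theorem measure_setOf_eventually_le {s : ℕ → Set Ω} {q : ENNReal} (h : ∀ n, P (s n) ≤ q) :
    P {ω | ∀ᶠ n in atTop, ω ∈ s n} ≤ q := by
  have : {ω | ∀ᶠ n in atTop, ω ∈ s n} = ⋃ N, ⋂ n ≥ N, s n := by
    ext ω; simp [eventually_atTop]
  rw [this, Monotone.measure_iUnion]
  · exact iSup_le fun N => (measure_mono (Set.biInter_subset_of_mem (le_refl N))).trans (h N)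
  · intro a b hab
    exact Set.biInter_subset_biInter_left fun n (hn : b ≤ n) => hab.trans hn

end DiscreteTime

/-! ### Rises of a Lévy process over short times. -/

section LevyProcess

theorem IsCadlagPath.sub_linear {f : ℝ → ℝ} (hf : IsCadlagPath f) (α : ℝ) :
    IsCadlagPath fun t => f t - α * t := fun t => by
  obtain ⟨h, l, hl⟩ := hf t
  have hc : Continuous fun s : ℝ => α * s := by fun_prop
  exact ⟨h.sub hc.continuousWithinAt, l - α * t,
    hl.sub (hc.continuousAt.tendsto.mono_left nhdsWithin_le_nhds)⟩

variable {Ω : Type*} [MeasurableSpace Ω] {P : Measure Ω} {X : ℝ → Ω → ℝ}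

theorem IsTwoSidedLevyProcess.sub_linear (hX : IsTwoSidedLevyProcess X P) (α : ℝ) :
    IsTwoSidedLevyProcess (fun t ω => X t ω - α * t) P where
  measurable t := (hX.measurable t).sub_const _
  cadlag ω := (hX.cadlag ω).sub_linear α
  zero ω := by simp [hX.zero ω]
  indepIncrements n t ht := by
    have := (hX.indepIncrements n t ht).comp
      (fun i x => x - (α * t i.succ - α * t i.castSucc)) (fun i => measurable_id.sub_const _)
    convert this using 2 with i
    funext ω
    simp only [Function.comp]
    ring
  stationaryIncrements s t h hh := by
    have := (hX.stationaryIncrements s t h hh).comp (u := fun x => x - α * h)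
      (measurable_id.sub_const _)
    convert this using 1 <;>
    · funext ω
      simp only [Function.comp]
      ring

theorem IsTwoSidedLevyProcess.iIndepFun_grid (hX : IsTwoSidedLevyProcess X P) (t : ℝ) {h : ℝ}
    (hh : 0 ≤ h) :
    iIndepFun (fun (i : ℕ) ω => X (t + (i + 1 : ℕ) * h) ω - X (t + i * h) ω) P := by
  refine hX.indepIncrements.nat (t := fun i : ℕ => t + i * h) ?_
  intro a b hab
  have : (a : ℝ) ≤ b := by exact_mod_cast hab
  simp only
  gcongr

theorem IsTwoSidedLevyProcess.measure_exists_increment_gt_eq (hX : IsTwoSidedLevyProcess X P)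
    (t : ℝ) {h : ℝ} (hh : 0 ≤ h) (W : ℕ) (x : ℝ) :
    P {ω | ∃ w ≤ W, x < X (t + w * h) ω - X t ω} = P {ω | ∃ w ≤ W, x < X (w * h) ω} := by
  have key : ∀ t, P {ω | ∃ w ≤ W, x < X (t + w * h) ω - X t ω} =
      P ((fun ω (i : ℕ) => X (t + (i + 1 : ℕ) * h) ω - X (t + i * h) ω) ⁻¹'
        {d | ∃ w ≤ W, x < ∑ i ∈ Finset.range w, d i}) := by
    intro t
    congr 1
    ext ω
    have : ∀ w : ℕ, ∑ i ∈ Finset.range w, (X (t + (i + 1 : ℕ) * h) ω - X (t + i * h) ω) =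
        X (t + w * h) ω - X t ω := by
      intro w
      rw [Finset.sum_range_sub (fun i : ℕ => X (t + i * h) ω)]
      simp
    simp only [Set.mem_ofPred_eq, Set.mem_preimage, this]
  have hB : MeasurableSet {d : ℕ → ℝ | ∃ w ≤ W, x < ∑ i ∈ Finset.range w, d i} := by
    have : {d : ℕ → ℝ | ∃ w ≤ W, x < ∑ i ∈ Finset.range w, d i} =
        ⋃ w ∈ Set.Iic W, {d | x < ∑ i ∈ Finset.range w, d i} := by
      ext d; simp
    rw [this]
    refine MeasurableSet.biUnion (Set.to_countable _) fun w _ => ?_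
    exact measurableSet_lt measurable_const
      (Finset.measurable_fun_sum _ fun i _ => measurable_pi_apply i)
  have hid : IdentDistrib (fun ω (i : ℕ) => X (t + (i + 1 : ℕ) * h) ω - X (t + i * h) ω)
      (fun ω (i : ℕ) => X (0 + (i + 1 : ℕ) * h) ω - X (0 + i * h) ω) P P := by
    refine IdentDistrib.pi (fun i => ?_) (hX.iIndepFun_grid t hh) (hX.iIndepFun_grid 0 hh)
    have := hX.stationaryIncrements (t + i * h) (0 + i * h) h hh
    convert this using 4 <;> push_cast <;> ring
  rw [key t, hid.measure_preimage_eq hB, ← key 0]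
  simp [hX.zero]

/-- Right-continuity at `0` makes the decreasing events have empty intersection; rational times keep
them measurable. -/
theorem IsTwoSidedLevyProcess.tendsto_measure_exists_gt [IsProbabilityMeasure P]
    (hX : IsTwoSidedLevyProcess X P) {x : ℝ} (hx : 0 < x) :
    Tendsto (fun m : ℕ => P {ω | ∃ s : ℚ, 0 ≤ s ∧ (s : ℝ) ≤ 1 / (m + 1) ∧ x < X s ω})
      atTop (𝓝 0) := by
  have hmeas : ∀ m : ℕ,
      MeasurableSet {ω | ∃ s : ℚ, 0 ≤ s ∧ (s : ℝ) ≤ 1 / (m + 1) ∧ x < X s ω} := by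
    intro m
    have : {ω | ∃ s : ℚ, 0 ≤ s ∧ (s : ℝ) ≤ 1 / (m + 1) ∧ x < X s ω} =
        ⋃ s ∈ {s : ℚ | 0 ≤ s ∧ (s : ℝ) ≤ 1 / (m + 1)}, {ω | x < X s ω} := by
      ext ω; simp [and_assoc]
    rw [this]
    exact MeasurableSet.biUnion (Set.to_countable _) fun s _ =>
      measurableSet_lt measurable_const (hX.measurable s)
  have hempty : ⋂ m : ℕ, {ω | ∃ s : ℚ, 0 ≤ s ∧ (s : ℝ) ≤ 1 / (m + 1) ∧ x < X s ω} = ∅ := by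
    rw [Set.eq_empty_iff_forall_notMem]
    intro ω hω
    rw [Set.mem_iInter] at hω
    have h0 := (hX.cadlag ω 0).1
    have : ∀ᶠ s in 𝓝[Set.Ici 0] (0 : ℝ), X s ω < x :=
      h0.eventually (gt_mem_nhds (by simpa [hX.zero ω] using hx))
    obtain ⟨δ, hδ, h⟩ := Metric.eventually_nhds_iff.1 (eventually_nhdsWithin_iff.1 this)
    obtain ⟨m, hm⟩ := exists_nat_one_div_lt hδ
    obtain ⟨s, hs0, hs1, hs⟩ := hω m
    have hs0' : (0 : ℝ) ≤ s := by exact_mod_cast hs0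
    have := h (y := (s : ℝ)) (by rw [Real.dist_eq, sub_zero, abs_of_nonneg hs0']; linarith) hs0'
    linarith
  have := tendsto_measure_iInter_atTop (μ := P) (fun m => (hmeas m).nullMeasurableSet)
    (fun a b hab ω ⟨s, h0, h1, h2⟩ => ⟨s, h0, h1.trans (by gcongr), h2⟩)
    ⟨0, measure_ne_top _ _⟩
  rwa [hempty, measure_empty] at this

theorem IsTwoSidedLevyProcess.measure_grid_rises_le [IsProbabilityMeasure P]
    (hX : IsTwoSidedLevyProcess X P) (u x ε : ℝ) (m n : ℕ) :
    P {ω | RisesAfterFirstPassage (fun i => X (u - n + i * (1 / 2 ^ n)) ω) (n * 2 ^ n)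
      ⌊(1 / (m + 1) : ℝ) * 2 ^ n⌋₊ ε x} ≤
    P {ω | ∃ s : ℚ, 0 ≤ s ∧ (s : ℝ) ≤ 1 / (m + 1) ∧ x < X s ω} := by
  refine measure_risesAfterFirstPassage_le (fun i ω => X (u - n + i * (1 / 2 ^ n)) ω)
    (fun i => hX.measurable _) (hX.iIndepFun_grid _ (by positivity)) _ _ _ _ _ fun k => ?_
  have h := hX.measure_exists_increment_gt_eq (u - n + k * (1 / 2 ^ n)) (h := 1 / 2 ^ n)
    (by positivity) ⌊(1 / (m + 1) : ℝ) * 2 ^ n⌋₊ x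
  have heq : ∀ w : ℕ, u - n + (k + w : ℕ) * (1 / 2 ^ n : ℝ) =
      u - n + k * (1 / 2 ^ n) + w * (1 / 2 ^ n) := by
    intro w; push_cast; ring
  simp only [heq]
  rw [h]
  refine measure_mono ?_
  rintro ω ⟨w, hw, hx⟩
  refine ⟨w * (1 / 2 ^ n), by positivity, ?_, by push_cast; exact hx⟩
  have : (w : ℝ) ≤ 1 / (m + 1) * 2 ^ n :=
    (Nat.le_floor_iff (by positivity)).1 hw
  push_cast
  rw [mul_one_div, div_le_iff₀ (by positivity)]
  exact this

end LevyProcess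

/-! ### Càdlàg paths that jump away from their infimum. -/

section Paths

/-- The path `y` has infimum `c` over `(-∞, u]`, stays away from `c` on every compact subinterval of
`[u, T)`, and jumps upwards at time `T` from the left limit `c`. -/
structure LeavesMinimumByJump (y : ℝ → ℝ) (u T c : ℝ) : Prop where
  lt : u < T
  le : ∀ s ≤ u, c ≤ y s
  near : ∀ ε > 0, ∃ r ≤ u, y r < c + ε
  gap : ∀ T' < T, ∃ ε > 0, ∀ v ∈ Set.Icc u T', c + ε ≤ y v
  lim : Tendsto y (𝓝[<] T) (𝓝 c)
  jump : c < y T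

theorem IsCadlagPath.exists_Ico {y : ℝ → ℝ} (hy : IsCadlagPath y) (t : ℝ) {U : Set ℝ}
    (hU : U ∈ 𝓝 (y t)) : ∃ θ > 0, ∀ s, t ≤ s → s < t + θ → y s ∈ U := by
  obtain ⟨θ, hθ, h⟩ := Metric.eventually_nhds_iff.1
    (eventually_nhdsWithin_iff.1 ((hy t).1.eventually hU))
  refine ⟨θ, hθ, fun s h1 h2 => h ?_ h1⟩
  rw [Real.dist_eq, abs_of_nonneg] <;> linarith

theorem exists_Ioo_of_tendsto_nhdsLT {y : ℝ → ℝ} {t c : ℝ} (h : Tendsto y (𝓝[<] t) (𝓝 c))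
    {U : Set ℝ} (hU : U ∈ 𝓝 c) : ∃ θ > 0, ∀ s, t - θ < s → s < t → y s ∈ U := by
  obtain ⟨θ, hθ, h⟩ := Metric.eventually_nhds_iff.1
    (eventually_nhdsWithin_iff.1 (h.eventually hU))
  refine ⟨θ, hθ, fun s h1 h2 => h ?_ h2⟩
  rw [Real.dist_eq, abs_of_neg] <;> linarith

theorem IsCadlagPath.exists_leavesMinimumByJump {y : ℝ → ℝ} (hy : IsCadlagPath y) {u t c : ℝ}
    (hut : u < t) (hle : ∀ s ≤ u, c ≤ y s) (hnear : ∀ ε > 0, ∃ r ≤ u, y r < c + ε)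
    (hpos : ∀ s ∈ Set.Icc u t, c < y s) (hlim : Tendsto y (𝓝[<] t) (𝓝 c)) :
    ∃ T, LeavesMinimumByJump y u T c := by
  set A : Set ℝ := {s | s ∈ Set.Icc u t ∧ ∃ ε > 0, ∀ v ∈ Set.Icc u s, c + ε ≤ y v} with hA
  have huA : u ∈ A := by
    refine ⟨⟨le_rfl, hut.le⟩, y u - c, sub_pos.2 (hpos u ⟨le_rfl, hut.le⟩), fun v hv => ?_⟩
    rw [le_antisymm hv.2 hv.1]; linarith
  have hAb : BddAbove A := ⟨t, fun s hs => hs.1.2⟩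
  set T := sSup A with hT
  have huT : u ≤ T := le_csSup hAb huA
  have hTt : T ≤ t := csSup_le ⟨u, huA⟩ fun s hs => hs.1.2
  have hjump : c < y T := hpos T ⟨huT, hTt⟩
  have hgap : ∀ T' < T, ∃ ε > 0, ∀ v ∈ Set.Icc u T', c + ε ≤ y v := by
    intro T' hT'
    obtain ⟨s, hs, hs'⟩ := exists_lt_of_lt_csSup ⟨u, huA⟩ hT'
    obtain ⟨-, ε, hε, h⟩ := hs
    exact ⟨ε, hε, fun v hv => h v ⟨hv.1, hv.2.trans hs'.le⟩⟩
  -- an initial interval on which `y` stays away from `c` cannot contain `T` unless `T = t`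
  have hext : (∃ ε > 0, ∀ v ∈ Set.Ico u T, c + ε ≤ y v) → T = t := by
    rintro ⟨ε, hε, h⟩
    by_contra hne
    have hTlt : T < t := lt_of_le_of_ne hTt hne
    obtain ⟨θ, hθ, hθ'⟩ := hy.exists_Ico T
      (U := Set.Ioi ((c + y T) / 2)) (Ioi_mem_nhds (by linarith))
    set s := min (T + θ / 2) t with hs
    have hTs : T < s := lt_min (by linarith) hTlt
    have hsA : s ∈ A := by
      refine ⟨⟨huT.trans hTs.le, min_le_right _ _⟩, min ε ((y T - c) / 2),
        lt_min hε (by linarith), fun v hv => ?_⟩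
      rcases lt_or_ge v T with hvT | hvT
      · linarith [h v ⟨hv.1, hvT⟩, min_le_left ε ((y T - c) / 2)]
      · have h1 : (c + y T) / 2 < y v :=
          hθ' v hvT (by linarith [hv.2, min_le_left (T + θ / 2) t])
        linarith [min_le_right ε ((y T - c) / 2)]
    exact absurd (le_csSup hAb hsA) (not_le.2 hTs)
  -- If `T = u`, then `Ico u T` is empty and `hext` would give `T = t > u`.
  have huT' : u < T := by
    rcases huT.eq_or_lt with h | h
    · have := hext ⟨1, one_pos, fun v hv => absurd (h ▸ hv.2) (not_lt.2 hv.1)⟩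
      linarith
    · exact h
  obtain ⟨l, hl⟩ := (hy T).2
  have hcl : c ≤ l := by
    refine ge_of_tendsto hl ?_
    filter_upwards [Ioo_mem_nhdsLT huT'] with s hs
    exact (hpos s ⟨hs.1.le, hs.2.le.trans hTt⟩).le
  -- A left limit above `c` would keep `y` away from `c` on all of `[u, T)`, so `T = t`, where the
  -- left limit is `c`.
  have hlc : l = c := by
    rcases hcl.eq_or_lt with h | h
    · exact h.symm
    · obtain ⟨θ, hθ, hθ'⟩ := exists_Ioo_of_tendsto_nhdsLT hl
        (U := Set.Ioi ((c + l) / 2)) (Ioi_mem_nhds (by linarith))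
      obtain ⟨ε, hε, hε'⟩ := hgap (T - θ / 2) (by linarith)
      have hTt' := hext ⟨min ε ((l - c) / 2), lt_min hε (by linarith), fun v hv => by
        rcases le_or_gt v (T - θ / 2) with hv' | hv'
        · linarith [hε' v ⟨hv.1, hv'⟩, min_le_left ε ((l - c) / 2)]
        · have h1 : (c + l) / 2 < y v := hθ' v (by linarith) hv.2
          linarith [min_le_right ε ((l - c) / 2)]⟩
      rw [hTt'] at hl
      exact tendsto_nhds_unique hl hlim
  exact ⟨T, huT', hle, hnear, hgap, hlc ▸ hl, hjump⟩

theorem LeavesMinimumByJump.exists_risesAfterFirstPassage {y : ℝ → ℝ} (hy : IsCadlagPath y)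
    {u T c : ℝ} (hL : LeavesMinimumByJump y u T c) :
    ∃ l : ℕ, ∀ m : ℕ, ∀ᶠ p : ℕ in atTop, ∀ᶠ n : ℕ in atTop,
      RisesAfterFirstPassage (fun i => y (u - n + i * (1 / 2 ^ n))) (n * 2 ^ n)
        ⌊(1 / (m + 1) : ℝ) * 2 ^ n⌋₊ (1 / (p + 1)) (1 / (l + 1)) := by
  obtain ⟨l, hl⟩ := exists_nat_one_div_lt (show (0 : ℝ) < (y T - c) / 2 by linarith [hL.jump])
  refine ⟨l, fun m => ?_⟩
  set x : ℝ := 1 / (l + 1) with hx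
  have hx0 : 0 < x := by positivity
  set η : ℝ := 1 / (m + 1) with hη
  have hη0 : 0 < η := by positivity
  obtain ⟨ε₁, hε₁, hgap₁⟩ := hL.gap (T - η / 2) (by linarith)
  obtain ⟨ε₂, hε₂, hgap₂⟩ := hL.gap u hL.lt
  -- The value at the passage is below `c + 2ε`. Thus `ε < ε₁ / 2` puts the passage after `T - η /
  -- 2`, and `ε < x / 2` leaves a rise of more than `x` up to a value above `c + 2x`; `ε < ε₂`
  -- forces `r < u`.
  have hsmall : ∀ᶠ p : ℕ in atTop, (1 : ℝ) / (p + 1) < min (min (ε₁ / 2) ε₂) (x / 2) :=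
    tendsto_one_div_add_atTop_nhds_zero_nat.eventually
      (gt_mem_nhds (lt_min (lt_min (by linarith) hε₂) (by linarith)))
  filter_upwards [hsmall] with p hp
  set ε : ℝ := 1 / (p + 1) with hε
  have hε0 : 0 < ε := by positivity
  obtain ⟨⟨hp₁, hp₂⟩, hp₃⟩ : (ε < ε₁ / 2 ∧ ε < ε₂) ∧ ε < x / 2 := by
    simpa only [lt_min_iff] using hp
  obtain ⟨r, hru, hr⟩ := hL.near ε hε0
  have hru' : r < u := by
    refine lt_of_le_of_ne hru ?_
    rintro rfl
    linarith [hgap₂ r ⟨le_rfl, le_rfl⟩]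
  obtain ⟨θ₁, hθ₁, hr'⟩ := hy.exists_Ico r (U := Set.Iio (c + ε)) (Iio_mem_nhds hr)
  obtain ⟨θ₂, hθ₂, hlim⟩ := exists_Ioo_of_tendsto_nhdsLT hL.lim (U := Set.Iio (c + ε))
    (Iio_mem_nhds (by linarith))
  obtain ⟨θ₃, hθ₃, hT'⟩ := hy.exists_Ico T (U := Set.Ioi (c + 2 * x))
    (Ioi_mem_nhds (by linarith))
  have hmesh : ∀ᶠ n : ℕ in atTop, (1 / 2 ^ n : ℝ) <
      min (min θ₁ (u - r)) (min (min θ₂ (T - u)) (min θ₃ (η / 2))) := by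
    have : Tendsto (fun n : ℕ => (1 / 2 ^ n : ℝ)) atTop (𝓝 0) := by
      simpa only [one_div, inv_pow] using tendsto_pow_atTop_nhds_zero_of_lt_one
        (show (0 : ℝ) ≤ 2⁻¹ by norm_num) (by norm_num)
    refine this.eventually (gt_mem_nhds ?_)
    have := hL.lt
    simp only [lt_min_iff]
    refine ⟨⟨?_, ?_⟩, ⟨?_, ?_⟩, ?_, ?_⟩ <;> linarith
  filter_upwards [hmesh, eventually_ge_atTop ⌈u - r⌉₊] with n hn hnr
  set h : ℝ := 1 / 2 ^ n with hh
  have hh0 : 0 < h := by positivity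
  simp only [lt_min_iff] at hn
  obtain ⟨⟨h₁, h₁'⟩, ⟨h₂, h₂'⟩, h₃, h₃'⟩ := hn
  have hnr' : u - r ≤ n := Nat.ceil_le.1 hnr
  set g : ℕ → ℝ := fun i => u - n + i * h with hg
  have hgM : g (n * 2 ^ n) = u := by
    simp only [hg, hh]
    push_cast
    field_simp
    ring
  have hgle : ∀ i j, g i ≤ g j ↔ i ≤ j := by
    intro i j
    simp only [hg, add_le_add_iff_left, mul_le_mul_iff_left₀ hh0, Nat.cast_le]
  have hgex : ∀ a, u - n ≤ a → ∃ i, a ≤ g i ∧ g i < a + h := by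
    intro a ha
    have h0 : 0 ≤ (a - (u - n)) / h := div_nonneg (by linarith) hh0.le
    refine ⟨⌈(a - (u - n)) / h⌉₊, ?_, ?_⟩
    · have := (div_le_iff₀ hh0).1 (Nat.le_ceil ((a - (u - n)) / h))
      simp only [hg]; linarith
    · have := mul_lt_mul_of_pos_right (Nat.ceil_lt_add_one h0) hh0
      rw [add_mul, div_mul_cancel₀ _ hh0.ne'] at this
      simp only [hg]; linarith
  generalize n * 2 ^ n = M at hgM ⊢
  have hn0 : (0 : ℝ) ≤ n := n.cast_nonneg
  obtain ⟨i₁, hi₁, hi₁'⟩ := hgex r (by linarith)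
  have hi₁M : i₁ ≤ M := by
    rw [← hgle, hgM]; linarith
  have hyi₁ : y (g i₁) < c + ε := hr' _ hi₁ (by linarith)
  -- Starting from `T - h` places this grid point strictly before `T`, where the left limit controls
  -- `y`.
  obtain ⟨i₂, hi₂, hi₂'⟩ := hgex (T - h) (by linarith)
  have hi₂M : M ≤ i₂ := by
    rw [← hgle, hgM]; linarith
  have hyi₂ : y (g i₂) < c + ε := hlim _ (by linarith) (by linarith)
  obtain ⟨i₃, hi₃, hi₃'⟩ := hgex T (by linarith [hL.lt])
  have hyi₃ : c + 2 * x < y (g i₃) := hT' _ hi₃ (by linarith)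
  have hex : ∃ k, ∀ i ≤ M, y (g (M + k)) - y (g i) < ε := by
    refine ⟨i₂ - M, fun i hi => ?_⟩
    rw [Nat.add_sub_cancel' hi₂M]
    have := hL.le (g i) (hgM ▸ (hgle i M).2 hi)
    linarith
  classical
  set k := Nat.find hex with hk
  have hkspec : ∀ i ≤ M, y (g (M + k)) - y (g i) < ε := Nat.find_spec hex
  have hkle : M + k ≤ i₂ := by
    have : k ≤ i₂ - M := Nat.find_min' hex fun i hi => by
      rw [Nat.add_sub_cancel' hi₂M]
      have := hL.le (g i) (hgM ▸ (hgle i M).2 hi)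
      linarith
    omega
  have hyk := hkspec i₁ hi₁M
  have hgk : T - η / 2 < g (M + k) := by
    by_contra hcon
    have := hgap₁ (g (M + k)) ⟨hgM ▸ (hgle M (M + k)).2 (Nat.le_add_right _ _), not_lt.1 hcon⟩
    linarith
  have hki₃ : M + k ≤ i₃ := hkle.trans ((hgle i₂ i₃).1 (by linarith))
  refine ⟨k, ⟨hkspec, fun k' hk' => ?_⟩, i₃ - (M + k), ?_, ?_⟩
  · have := Nat.find_min hex hk'
    push Not at this
    exact this
  · rw [Nat.le_floor_iff (by positivity), Nat.cast_sub hki₃]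
    have h4 : ((i₃ : ℝ) - (M + k : ℕ)) * h ≤ η := by
      have : ((i₃ : ℝ) - (M + k : ℕ)) * h = g i₃ - g (M + k) := by simp only [hg]; ring
      linarith
    rw [hh, mul_one_div, div_le_iff₀ (by positivity)] at h4
    exact h4
  · rw [Nat.add_sub_cancel' hki₃]
    change x < y (g i₃) - y (g (M + k))
    linarith

end Paths

/-! ### Path properties of the contact and ladder sets. -/

section ContactSet

variable {α : ℝ} {f : ℝ → ℝ} {t : ℝ}

theorem mem_ladderTimeSet_iff :
    t ∈ ladderTimeSet α f ↔ ∀ u ≤ t, f t - α * t ≤ f u - α * u := by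
  constructor
  · intro h u hu
    have h' : ((f t - α * t : ℝ) : EReal) = ⨅ (u : ℝ) (_ : u ≤ t), ((f u - α * u : ℝ) : EReal) := h
    exact EReal.coe_le_coe_iff.1 (h'.trans_le (iInf₂_le u hu))
  · intro h
    exact le_antisymm (le_iInf₂ fun u hu => EReal.coe_le_coe_iff.2 (h u hu))
      (iInf₂_le (f := fun u (_ : u ≤ t) => ((f u - α * u : ℝ) : EReal)) t le_rfl)

theorem IsCadlagPath.tendsto_leftLim (hf : IsCadlagPath f) (t : ℝ) :
    Tendsto f (𝓝[<] t) (𝓝 (Function.leftLim f t)) :=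
  tendsto_leftLim_of_tendsto (hf t).2

theorem IsCadlagPath.tendsto_sub_linear (hf : IsCadlagPath f) (α t : ℝ) :
    Tendsto (fun s => f s - α * s) (𝓝[<] t) (𝓝 (Function.leftLim f t - α * t)) := by
  have hc : Continuous fun s : ℝ => α * s := by fun_prop
  exact (hf.tendsto_leftLim t).sub (hc.continuousAt.tendsto.mono_left nhdsWithin_le_nhds)

/-- The other inequality is automatic: the envelope at `t` is at most `f t` and, on letting `s`
increase to `t`, at most the left limit. -/
theorem IsCadlagPath.mem_contactSet_iff (hf : IsCadlagPath f) :
    t ∈ contactSet α f ↔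
      ∀ s ≤ t, min (f t) (Function.leftLim f t) - α * t ≤ f s - α * s := by
  have hiff : ∀ s, min (f t) (Function.leftLim f t) - α * t ≤ f s - α * s ↔
      min (f t) (Function.leftLim f t) ≤ f s + α * (t - s) := by
    intro s
    rw [mul_sub]
    constructor <;> intro h <;> linarith
  simp only [hiff]
  constructor
  · intro h s hs
    have h' : ((min (f t) (Function.leftLim f t) : ℝ) : EReal) = lowerEnvelope α f t := h
    exact EReal.coe_le_coe_iff.1 (h'.trans_le (iInf₂_le s hs))
  · intro h
    refine le_antisymm (le_iInf₂ fun s hs => EReal.coe_le_coe_iff.2 (h s hs)) ?_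
    have hinf : ∀ s ≤ t, lowerEnvelope α f t ≤ ((f s + α * (t - s) : ℝ) : EReal) :=
      fun s hs => iInf₂_le (f := fun s (_ : s ≤ t) => ((f s + α * (t - s) : ℝ) : EReal)) s hs
    rw [EReal.coe_strictMono.monotone.map_min]
    refine le_min ?_ ?_
    · refine (hinf t le_rfl).trans ?_
      simp
    · have hc : Continuous fun s : ℝ => α * (t - s) := by fun_prop
      have hl : Tendsto (fun s => f s + α * (t - s)) (𝓝[<] t) (𝓝 (Function.leftLim f t)) := by
        simpa using (hf.tendsto_leftLim t).add
          (hc.continuousAt.tendsto.mono_left nhdsWithin_le_nhds)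
      refine ge_of_tendsto (EReal.tendsto_coe.2 hl) ?_
      filter_upwards [self_mem_nhdsWithin] with s hs
      exact hinf s (le_of_lt hs)

theorem IsCadlagPath.ladderTimeSet_subset_contactSet (hf : IsCadlagPath f) :
    ladderTimeSet α f ⊆ contactSet α f := by
  intro t ht
  rw [hf.mem_contactSet_iff]
  rw [mem_ladderTimeSet_iff] at ht
  intro s hs
  linarith [ht s hs, min_le_left (f t) (Function.leftLim f t)]

theorem IsCadlagPath.isClosedFromRight_ladderTimeSet (hf : IsCadlagPath f) :
    IsClosedFromRight (ladderTimeSet α f) := by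
  intro u t hu hlim hmem
  have hge : ∀ n, t ≤ u n := fun n => hu.le_of_tendsto hlim n
  have hy : Tendsto (fun n => f (u n) - α * u n) atTop (𝓝 (f t - α * t)) :=
    ((hf.sub_linear α) t).1.tendsto.comp
      (tendsto_nhdsWithin_iff.2 ⟨hlim, Eventually.of_forall hge⟩)
  rw [mem_ladderTimeSet_iff]
  intro s hs
  exact le_of_tendsto hy (Eventually.of_forall fun n =>
    mem_ladderTimeSet_iff.1 (hmem n) s (hs.trans (hge n)))

theorem IsCadlagPath.closure_ladderTimeSet_subset (hf : IsCadlagPath f) :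
    closure (ladderTimeSet α f) ⊆ contactSet α f := by
  intro t ht
  by_cases htR : t ∈ ladderTimeSet α f
  · exact hf.ladderTimeSet_subset_contactSet htR
  have hfreq : ∃ᶠ s in 𝓝[≠] t, s ∈ ladderTimeSet α f := by
    rw [mem_closure_iff_frequently] at ht
    refine frequently_nhdsWithin_iff.2 (ht.mono fun s hs => ⟨hs, ?_⟩)
    rintro rfl
    exact htR hs
  rw [← nhdsLT_sup_nhdsGT, frequently_sup] at hfreq
  rw [hf.mem_contactSet_iff]
  rcases hfreq with h | h
  · -- ladder times accumulating from the left force the left limit to be the infimum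
    have hlt : ∀ s < t, Function.leftLim f t - α * t ≤ f s - α * s := by
      intro s hs
      refine le_of_tendsto_of_frequently (hf.tendsto_sub_linear α t) ?_
      refine (h.and_eventually (Ioo_mem_nhdsLT hs)).mono fun r hr => ?_
      exact mem_ladderTimeSet_iff.1 hr.1 s hr.2.1.le
    intro s hs
    rcases hs.eq_or_lt with rfl | hs
    · linarith [min_le_left (f s) (Function.leftLim f s)]
    · linarith [hlt s hs, min_le_right (f t) (Function.leftLim f t)]
  · refine absurd (mem_ladderTimeSet_iff.2 fun s hs => ?_) htR
    refine le_of_tendsto_of_frequently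
      (((hf.sub_linear α) t).1.tendsto.mono_left (nhdsWithin_mono t Set.Ioi_subset_Ici_self)) ?_
    refine (h.and_eventually self_mem_nhdsWithin).mono fun r hr => ?_
    exact mem_ladderTimeSet_iff.1 hr.1 s (hs.trans (le_of_lt hr.2))

theorem IsCadlagPath.leftLim_lt_of_mem_contactSet_diff (hf : IsCadlagPath f)
    (ht : t ∈ contactSet α f \ ladderTimeSet α f) :
    Function.leftLim f t < f t ∧ ∀ s ≤ t, Function.leftLim f t - α * t ≤ f s - α * s := by
  obtain ⟨h1, h2⟩ := ht
  rw [hf.mem_contactSet_iff] at h1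
  have hlt : Function.leftLim f t < f t := by
    by_contra hcon
    rw [min_eq_left (not_lt.1 hcon)] at h1
    exact h2 (mem_ladderTimeSet_iff.2 h1)
  rw [min_eq_right hlt.le] at h1
  exact ⟨hlt, h1⟩

theorem IsCadlagPath.isIsolatedOnRight_contactSet (hf : IsCadlagPath f)
    (ht : t ∈ contactSet α f \ ladderTimeSet α f) : IsIsolatedOnRight (contactSet α f) t := by
  refine ⟨ht.1, ?_⟩
  obtain ⟨hlt, hle⟩ := hf.leftLim_lt_of_mem_contactSet_diff ht
  set c := Function.leftLim f t - α * t with hc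
  set b := (c + (f t - α * t)) / 2 with hb
  have hcb : c < b := by linarith
  obtain ⟨θ, hθ, h⟩ := (hf.sub_linear α).exists_Ico t (U := Set.Ioi b)
    (Ioi_mem_nhds (by linarith))
  refine ⟨θ, hθ, Set.eq_empty_of_forall_notMem ?_⟩
  rintro s ⟨⟨hs1, hs2⟩, hs⟩
  rw [hf.mem_contactSet_iff] at hs
  have h1 : b < f s - α * s := h s hs1.le hs2
  have h2 : b ≤ Function.leftLim f s - α * s := by
    refine ge_of_tendsto (hf.tendsto_sub_linear α s) ?_
    filter_upwards [Ioo_mem_nhdsLT hs1] with r hr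
    exact (h r hr.1.le (hr.2.trans hs2)).le
  have h3 : b ≤ min (f s) (Function.leftLim f s) - α * s := by
    rcases min_choice (f s) (Function.leftLim f s) with e | e <;> rw [e] <;> linarith
  have h4 : c < f t - α * t := by linarith
  -- Contact at `s` bounds the path before `t` below by `b`, hence also its left limit `c` at `t`.
  have h5 : c ≥ b := by
    refine ge_of_tendsto (hf.tendsto_sub_linear α t) ?_
    filter_upwards [self_mem_nhdsWithin] with r hr
    exact h3.trans (hs r ((le_of_lt hr).trans hs1.le))
  linarith

theorem IsIsolatedOnRight.countable {S T : Set ℝ}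
    (h : ∀ t ∈ T, IsIsolatedOnRight S t) : T.Countable := by
  refine (countable_setOfPred_isolated_right_within (s := S)).mono fun t ht => ?_
  obtain ⟨hS, ε, hε, h⟩ := h t ht
  refine ⟨hS, ?_⟩
  rw [← empty_mem_iff_bot, ← h]
  filter_upwards [self_mem_nhdsWithin, mem_nhdsWithin_of_mem_nhds
    (Iio_mem_nhds (show t < t + ε by linarith))] with s hs hs'
  exact ⟨⟨hs.2, hs'⟩, hs.1⟩

/-- If `y` gets strictly below its infimum over `(-∞, v]` before time `t`, then it does so first at
or after a ladder time in `[v, t)`. -/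
theorem IsCadlagPath.exists_ladderTime (hf : IsCadlagPath f) {v t c : ℝ}
    (hv : ∀ s ≤ v, c ≤ f s - α * s) (ht : ∃ s < t, f s - α * s < c) :
    ∃ τ ∈ ladderTimeSet α f, v ≤ τ ∧ τ < t := by
  set B : Set ℝ := {s | f s - α * s < c} with hB
  obtain ⟨s₀, hs₀t, hs₀⟩ := ht
  have hvB : ∀ s ∈ B, v ≤ s := fun s hs => by
    by_contra hcon
    exact absurd (hv s (not_le.1 hcon).le) (not_le.2 hs)
  have hBb : BddBelow B := ⟨v, hvB⟩
  have hBn : B.Nonempty := ⟨s₀, hs₀⟩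
  refine ⟨sInf B, mem_ladderTimeSet_iff.2 fun u hu => ?_, le_csInf hBn hvB,
    (csInf_le hBb hs₀).trans_lt hs₀t⟩
  -- Points of `B` lie at or arbitrarily close to the right of `sInf B`, so right-continuity
  -- applies.
  have hτ : f (sInf B) - α * sInf B ≤ c := by
    by_contra hcon
    obtain ⟨θ, hθ, h⟩ := (hf.sub_linear α).exists_Ico (sInf B) (U := Set.Ioi c)
      (Ioi_mem_nhds (not_le.1 hcon))
    obtain ⟨s, hs, hs'⟩ := exists_lt_of_csInf_lt hBn (show sInf B < sInf B + θ by linarith)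
    have h1 : c < f s - α * s := h s (csInf_le hBb hs) hs'
    have h2 : f s - α * s < c := hs
    linarith
  rcases hu.eq_or_lt with rfl | hu
  · exact le_rfl
  · have : u ∉ B := notMem_of_lt_csInf hu hBb
    exact hτ.trans (not_lt.1 this)

theorem IsCadlagPath.exists_leavesMinimumByJump_of_notMem_closure (hf : IsCadlagPath f)
    (ht : t ∈ contactSet α f) (htR : t ∉ closure (ladderTimeSet α f)) :
    ∃ (u : ℚ) (T c : ℝ), LeavesMinimumByJump (fun s => f s - α * s) u T c := by
  obtain ⟨hlt, hle⟩ :=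
    hf.leftLim_lt_of_mem_contactSet_diff ⟨ht, fun h => htR (subset_closure h)⟩
  have hlim := hf.tendsto_sub_linear α t
  set c := Function.leftLim f t - α * t with hc
  obtain ⟨θ, hθ, hball⟩ := Metric.mem_nhds_iff.1 (isClosed_closure.isOpen_compl.mem_nhds htR)
  have hno : ∀ s, t - θ < s → s < t → s ∉ ladderTimeSet α f := fun s h1 h2 h3 =>
    hball (by rw [Metric.mem_ball, Real.dist_eq, abs_of_neg] <;> linarith) (subset_closure h3)
  obtain ⟨u, hu1, hu2⟩ := exists_rat_btwn (show t - θ < t by linarith)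
  have hnear : ∀ ε > 0, ∃ r ≤ (u : ℝ), f r - α * r < c + ε := by
    intro ε hε
    by_contra! hcon
    obtain ⟨s, hs, hs'⟩ := ((hlim.eventually (gt_mem_nhds (show c < c + ε by linarith))).and
      self_mem_nhdsWithin).exists
    obtain ⟨τ, hτ, h1, h2⟩ := hf.exists_ladderTime hcon ⟨s, hs', hs⟩
    exact hno τ (by linarith) h2 hτ
  have hgt : ∀ s ∈ Set.Icc (u : ℝ) t, c < f s - α * s := by
    intro s hs
    rcases hs.2.eq_or_lt with rfl | hst
    · linarith
    · refine lt_of_le_of_ne (hle s hs.2) fun heq => hno s (by linarith [hs.1]) hst ?_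
      exact mem_ladderTimeSet_iff.2 fun r hr => heq ▸ hle r (hr.trans hs.2)
  obtain ⟨T, hT⟩ := (hf.sub_linear α).exists_leavesMinimumByJump hu2
    (fun s hs => hle s (hs.trans hu2.le)) hnear hgt hlim
  exact ⟨u, T, c, hT⟩

end ContactSet

/-! ### Absence of predictable jumps, and the conclusion. -/

theorem IsTwoSidedLevyProcess.ae_not_leavesMinimumByJump {Ω : Type*} [MeasurableSpace Ω]
    {P : Measure Ω} [IsProbabilityMeasure P] {X : ℝ → Ω → ℝ} (hX : IsTwoSidedLevyProcess X P) :
    ∀ᵐ ω ∂P, ∀ (u : ℚ) (T c : ℝ), ¬ LeavesMinimumByJump (fun t => X t ω) u T c := by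
  rw [ae_all_iff]
  intro u
  set E : ℕ → ℕ → ℕ → ℕ → Set Ω := fun l m p n =>
    {ω | RisesAfterFirstPassage (fun i => X (u - n + i * (1 / 2 ^ n)) ω) (n * 2 ^ n)
      ⌊(1 / (m + 1) : ℝ) * 2 ^ n⌋₊ (1 / (p + 1)) (1 / (l + 1))} with hE
  have hzero : ∀ l, P {ω | ∀ m, ∀ᶠ p in atTop, ∀ᶠ n in atTop, ω ∈ E l m p n} = 0 := by
    intro l
    -- The bound is uniform in `p` and `n`, so both limits are taken before `m → ∞`.
    refine le_antisymm (ge_of_tendsto' (hX.tendsto_measure_exists_gt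
      (x := 1 / (l + 1)) (by positivity)) fun m => ?_) zero_le
    calc P {ω | ∀ m, ∀ᶠ p in atTop, ∀ᶠ n in atTop, ω ∈ E l m p n}
        ≤ P {ω | ∀ᶠ p in atTop, ω ∈ {ω | ∀ᶠ n in atTop, ω ∈ E l m p n}} :=
          measure_mono fun ω hω => hω m
      _ ≤ _ := measure_setOf_eventually_le fun p =>
          measure_setOf_eventually_le fun n => hX.measure_grid_rises_le u _ _ m n
  have hae : ∀ᵐ ω ∂P, ∀ l, ¬ ∀ m, ∀ᶠ p in atTop, ∀ᶠ n in atTop, ω ∈ E l m p n :=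
    ae_all_iff.2 fun l => by
      rw [ae_iff]
      simpa only [not_not] using hzero l
  filter_upwards [hae] with ω hω T c hL
  obtain ⟨l, hl⟩ := hL.exists_risesAfterFirstPassage (hX.cadlag ω)
  exact hω l hl

/-- Neither `hpos` nor `hα` is needed: they ensure that the infima defining the two sets are
finite, and a time at which the infimum is `-∞` lies in neither set. -/
theorem propositionP {Ω : Type*} [MeasurableSpace Ω] (P : Measure Ω) [IsProbabilityMeasure P]
    (X : ℝ → Ω → ℝ) (hX : IsTwoSidedLevyProcess X P)
    (hpos : Integrable (fun ω => max (X 1 ω) 0) P)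
    (α : ℝ) (hα : extExpectation (X 1) P < (α : EReal)) :
    ∀ᵐ ω ∂P,
      ladderTimeSet α (fun t => X t ω) ⊆ contactSet α (fun t => X t ω) ∧
      IsClosedFromRight (ladderTimeSet α (fun t => X t ω)) ∧
      closure (ladderTimeSet α (fun t => X t ω)) = contactSet α (fun t => X t ω) ∧
      (∀ t ∈ contactSet α (fun t => X t ω) \ ladderTimeSet α (fun t => X t ω),
        IsIsolatedOnRight (contactSet α (fun t => X t ω)) t) ∧
      (contactSet α (fun t => X t ω) \ ladderTimeSet α (fun t => X t ω)).Countable := by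
  filter_upwards [(hX.sub_linear α).ae_not_leavesMinimumByJump] with ω hω
  have hf := hX.cadlag ω
  have hiso : ∀ t ∈ contactSet α (fun t => X t ω) \ ladderTimeSet α (fun t => X t ω),
      IsIsolatedOnRight (contactSet α (fun t => X t ω)) t :=
    fun t ht => hf.isIsolatedOnRight_contactSet ht
  refine ⟨hf.ladderTimeSet_subset_contactSet, hf.isClosedFromRight_ladderTimeSet,
    hf.closure_ladderTimeSet_subset.antisymm fun t ht => ?_, hiso,
    IsIsolatedOnRight.countable hiso⟩
  by_contra htR
  obtain ⟨u, T, c, h⟩ := hf.exists_leavesMinimumByJump_of_notMem_closure ht htR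
  exact hω u T c h
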